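/- Let $\Bbbk$ be an arbitrary field. All algebras are $\Bbbk$-vector spaces with bilinear operations, not necessarily unital; write $(a,b,c)=(a\circ b)\circ c-a\circ(b\circ c)$ for the associator. A left-symmetric algebra is an algebra $(A,\circ)$ satisfying $(a,b,c)=(b,a,c)$. An SLS-algebra is a left-symmetric algebra that also satisfies $$((x\circ y)\circ z)\circ u=((x\circ z)\circ y)\circ u,\qquad (x,\,y\circ z,\,u)=(y,\,x\circ z,\,u).$$ A Perm-algebra is an associative algebra satisfying $xyz=yxz$, and a differential Perm-algebra is a Perm-algebra with a linear map $d$ such that $d(ab)=d(a)b+a\,d(b)$. For a set $X$, let $\mathrm{SLS}\langle X\rangle$ be the free SLS-algebra and $\mathrm{PermDer}\langle X,d\rangle$ the free differential Perm-algebra generated by $X$. A left-symmetric algebra $A$ is called special if there are a differential Perm-algebra $(P,d)$ and an injective linear map $j:A\to P$ such that $j(a\circ b)=j(a)\,d(j(b))$ for all $a,b\in A$. Theorem. Let $X$ be a nonempty set, and let $F$ be the subalgebra generated by $X$ in $\mathrm{PermDer}\langle X,d\rangle$ relative to the operation $f\circ g=f\,d(g)$. Then there is an isomorphism of algebras $\mathrm{SLS}\langle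 X\rangle\to (F,\circ)$ that maps each generator $x\in X$ to $x$. In particular, the free SLS-algebra $\mathrm{SLS}\langle X\rangle$ is special. -/

import Mathlib

universe u v w

noncomputable section

/-! ### SLS-algebras -/

/-- Left-symmetric (left pre-Lie) rings satisfying the two identities of SLS-algebras.
An SLS-algebra over a field `k` is an `SLSRing A` together with `LeftPreLieAlgebra k A`. -/
class SLSRing (A : Type*) extends LeftPreLieRing A where
  mul_mul_mul_comm' (x y z u : A) : ((x * y) * z) * u = ((x * z) * y) * u
  associator_mul_comm' (x y z u : A) : associator x (y * z) u = associator y (x * z) u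

section FreeSLS

variable (k : Type u) [Field k] (X : Type v)

/-- The quotient of the free nonassociative algebra on `X` by the equivalence relation generated
by this relation (equivalently, by the ideal generated by all values of the defining identities)
is the free SLS-algebra. -/
inductive FreeSLS.Rel :
    FreeNonUnitalNonAssocAlgebra k X → FreeNonUnitalNonAssocAlgebra k X → Prop
  | left_symm (x y z) : FreeSLS.Rel (associator x y z) (associator y x z)
  | mul_mul_mul_comm (x y z u) : FreeSLS.Rel (((x * y) * z) * u) (((x * z) * y) * u)
  | associator_mul_comm (x y z u) :
      FreeSLS.Rel (associator x (y * z) u) (associator y (x * z) u)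
  | smul (t : k) {a b} : FreeSLS.Rel a b → FreeSLS.Rel (t • a) (t • b)
  | add_right {a b} (c) : FreeSLS.Rel a b → FreeSLS.Rel (a + c) (b + c)
  | mul_left (a) {b c} : FreeSLS.Rel b c → FreeSLS.Rel (a * b) (a * c)
  | mul_right {a b} (c) : FreeSLS.Rel a b → FreeSLS.Rel (a * c) (b * c)

/-- The free SLS-algebra over `k` generated by the set `X`. -/
def FreeSLS : Type (max u v) := Quot (FreeSLS.Rel k X)

namespace FreeSLS

variable {k X}

theorem Rel.add_left (a : FreeNonUnitalNonAssocAlgebra k X)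
    {b c : FreeNonUnitalNonAssocAlgebra k X} (h : Rel k X b c) : Rel k X (a + b) (a + c) := by
  rw [add_comm _ b, add_comm _ c]; exact h.add_right _

theorem Rel.neg {a b : FreeNonUnitalNonAssocAlgebra k X} (h : Rel k X a b) :
    Rel k X (-a) (-b) := by
  simpa only [neg_one_smul] using h.smul (-1)

theorem Rel.sub_left (a : FreeNonUnitalNonAssocAlgebra k X)
    {b c : FreeNonUnitalNonAssocAlgebra k X} (h : Rel k X b c) : Rel k X (a - b) (a - c) := by
  simpa only [sub_eq_add_neg] using h.neg.add_left a

theorem Rel.sub_right {a b : FreeNonUnitalNonAssocAlgebra k X}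
    (c : FreeNonUnitalNonAssocAlgebra k X) (h : Rel k X a b) : Rel k X (a - c) (b - c) := by
  simpa only [sub_eq_add_neg] using h.add_right (-c)

instance : SMul k (FreeSLS k X) where
  smul t := Quot.map (t • ·) fun _ _ => Rel.smul t

instance : Zero (FreeSLS k X) where
  zero := Quot.mk _ 0

instance : Add (FreeSLS k X) where
  add := Quot.map₂ (· + ·) (fun _ _ _ => Rel.add_left _) fun _ _ _ => Rel.add_right _

instance : Neg (FreeSLS k X) where
  neg := Quot.map Neg.neg fun _ _ => Rel.neg

instance : Sub (FreeSLS k X) where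
  sub := Quot.map₂ Sub.sub (fun _ _ _ => Rel.sub_left _) fun _ _ _ => Rel.sub_right _

instance : Mul (FreeSLS k X) where
  mul := Quot.map₂ (· * ·) (fun _ _ _ => Rel.mul_left _) fun _ _ _ => Rel.mul_right _

instance : AddCommGroup (FreeSLS k X) where
  add_assoc := by rintro ⟨a⟩ ⟨b⟩ ⟨c⟩; exact congrArg (Quot.mk _) (add_assoc a b c)
  zero_add := by rintro ⟨a⟩; exact congrArg (Quot.mk _) (zero_add a)
  add_zero := by rintro ⟨a⟩; exact congrArg (Quot.mk _) (add_zero a)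
  add_comm := by rintro ⟨a⟩ ⟨b⟩; exact congrArg (Quot.mk _) (add_comm a b)
  neg_add_cancel := by rintro ⟨a⟩; exact congrArg (Quot.mk _) (neg_add_cancel a)
  sub_eq_add_neg := by rintro ⟨a⟩ ⟨b⟩; exact congrArg (Quot.mk _) (sub_eq_add_neg a b)
  nsmul := nsmulRec
  zsmul := zsmulRec

instance : NonUnitalNonAssocRing (FreeSLS k X) where
  left_distrib := by rintro ⟨a⟩ ⟨b⟩ ⟨c⟩; exact congrArg (Quot.mk _) (mul_add a b c)
  right_distrib := by rintro ⟨a⟩ ⟨b⟩ ⟨c⟩; exact congrArg (Quot.mk _) (add_mul a b c)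
  zero_mul := by rintro ⟨a⟩; exact congrArg (Quot.mk _) (zero_mul a)
  mul_zero := by rintro ⟨a⟩; exact congrArg (Quot.mk _) (mul_zero a)

instance : SLSRing (FreeSLS k X) where
  assoc_symm' := by rintro ⟨a⟩ ⟨b⟩ ⟨c⟩; exact Quot.sound (Rel.left_symm a b c)
  mul_mul_mul_comm' := by
    rintro ⟨a⟩ ⟨b⟩ ⟨c⟩ ⟨e⟩; exact Quot.sound (Rel.mul_mul_mul_comm a b c e)
  associator_mul_comm' := by
    rintro ⟨a⟩ ⟨b⟩ ⟨c⟩ ⟨e⟩; exact Quot.sound (Rel.associator_mul_comm a b c e)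

instance : Module k (FreeSLS k X) :=
  Function.Surjective.module k ⟨⟨Quot.mk (Rel k X), rfl⟩, fun _ _ => rfl⟩
    Quot.mk_surjective (fun _ _ => rfl)

instance : LeftPreLieAlgebra k (FreeSLS k X) where
  smul_assoc := by rintro t ⟨a⟩ ⟨b⟩; exact congrArg (Quot.mk _) (smul_mul_assoc t a b)
  smul_comm := by rintro t ⟨a⟩ ⟨b⟩; exact congrArg (Quot.mk _) (mul_smul_comm t a b).symm

variable (k)

/-- The free generators. -/
def of (x : X) : FreeSLS k X := Quot.mk _ (FreeNonUnitalNonAssocAlgebra.of k x)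

/-- The universal property of the free SLS-algebra. -/
theorem existsUnique_lift {A : Type w} [SLSRing A] [LeftPreLieAlgebra k A] (f : X → A) :
    ∃! φ : FreeSLS k X →ₙₐ[k] A, ∀ x, φ (of k x) = f x := by
  let F := FreeNonUnitalNonAssocAlgebra.lift k f
  have hF : ∀ a b, Rel k X a b → F a = F b := by
    intro a b h
    induction h with
    | left_symm x y z =>
      simpa [associator] using LeftPreLieRing.assoc_symm (F x) (F y) (F z)
    | mul_mul_mul_comm x y z u =>
      simpa using SLSRing.mul_mul_mul_comm' (F x) (F y) (F z) (F u)
    | associator_mul_comm x y z u =>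
      simpa [associator] using SLSRing.associator_mul_comm' (F x) (F y) (F z) (F u)
    | smul t _ ih => simp only [map_smul, ih]
    | add_right c _ ih => simp only [map_add, ih]
    | mul_left a _ ih => simp only [map_mul, ih]
    | mul_right c _ ih => simp only [map_mul, ih]
  let mk : FreeNonUnitalNonAssocAlgebra k X →ₙₐ[k] FreeSLS k X :=
    { toFun := Quot.mk (Rel k X)
      map_smul' := fun _ _ => rfl
      map_zero' := rfl
      map_add' := fun _ _ => rfl
      map_mul' := fun _ _ => rfl }
  refine ⟨{ toFun := fun c => Quot.liftOn c F hF
            map_smul' := ?_, map_zero' := map_zero F, map_add' := ?_, map_mul' := ?_ }, ?_, ?_⟩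
  · rintro t ⟨a⟩; exact map_smul F t a
  · rintro ⟨a⟩ ⟨b⟩; exact map_add F a b
  · rintro ⟨a⟩ ⟨b⟩; exact map_mul F a b
  · intro x; exact FreeNonUnitalNonAssocAlgebra.lift_of_apply k f x
  · intro ψ hψ
    ext ⟨a⟩
    have h : ψ.comp mk = F := FreeNonUnitalNonAssocAlgebra.hom_ext k fun x => by
      rw [FreeNonUnitalNonAssocAlgebra.lift_of_apply]; exact hψ x
    exact NonUnitalAlgHom.congr_fun h a

end FreeSLS

end FreeSLS

/-! ### Differential Perm-algebras -/

/-- Associative (not necessarily unital) rings satisfying the Perm identity `xyz = yxz`. -/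
class PermRing (P : Type*) extends NonUnitalRing P where
  mul_left_comm' (x y z : P) : (x * y) * z = (y * x) * z

/-- An algebra over a field `k` whose underlying ring is a `PermRing`, together with a
derivation `diff`. -/
class DiffPermAlgebra (k : Type*) [Field k] (P : Type*) [PermRing P] extends
    Module k P, IsScalarTower k P P, SMulCommClass k P P where
  /-- The derivation. -/
  diff' : P →ₗ[k] P
  leibniz' (a b : P) : diff' (a * b) = diff' a * b + a * diff' b

/-- The derivation of a differential Perm-algebra. -/
def DiffPermAlgebra.diff (k : Type*) [Field k] {P : Type*} [PermRing P] [DiffPermAlgebra k P] :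
    P →ₗ[k] P :=
  DiffPermAlgebra.diff'

theorem DiffPermAlgebra.diff_mul (k : Type*) [Field k] {P : Type*} [PermRing P]
    [DiffPermAlgebra k P] (a b : P) :
    diff k (a * b) = diff k a * b + a * diff k b :=
  DiffPermAlgebra.leibniz' a b

section FreePermDer

variable (k : Type u) [Field k] (X : Type v)

/-- Formal terms in the signature of differential algebras over `k`, with variables in `X`. -/
inductive FreePermDer.Term : Type (max u v)
  | of (x : X)
  | zero
  | add (a b : FreePermDer.Term)
  | smul (t : k) (a : FreePermDer.Term)
  | mul (a b : FreePermDer.Term)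
  | diff (a : FreePermDer.Term)

open FreePermDer.Term in
/-- The axioms of differential Perm-algebras over `k`, closed under all operations. -/
inductive FreePermDer.Rel : FreePermDer.Term k X → FreePermDer.Term k X → Prop
  -- vector space
  | add_assoc (a b c) : FreePermDer.Rel (add (add a b) c) (add a (add b c))
  | add_comm (a b) : FreePermDer.Rel (add a b) (add b a)
  | zero_add (a) : FreePermDer.Rel (add zero a) a
  | smul_add (t : k) (a b) : FreePermDer.Rel (smul t (add a b)) (add (smul t a) (smul t b))
  | add_smul (s t : k) (a) : FreePermDer.Rel (smul (s + t) a) (add (smul s a) (smul t a))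
  | smul_smul (s t : k) (a) : FreePermDer.Rel (smul (s * t) a) (smul s (smul t a))
  | one_smul (a) : FreePermDer.Rel (smul 1 a) a
  | zero_smul (a) : FreePermDer.Rel (smul 0 a) zero
  -- bilinear, associative, left commutative product
  | left_distrib (a b c) : FreePermDer.Rel (mul a (add b c)) (add (mul a b) (mul a c))
  | right_distrib (a b c) : FreePermDer.Rel (mul (add a b) c) (add (mul a c) (mul b c))
  | smul_mul (t : k) (a b) : FreePermDer.Rel (mul (smul t a) b) (smul t (mul a b))
  | mul_smul (t : k) (a b) : FreePermDer.Rel (mul a (smul t b)) (smul t (mul a b))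
  | mul_assoc (a b c) : FreePermDer.Rel (mul (mul a b) c) (mul a (mul b c))
  | mul_left_comm (a b c) : FreePermDer.Rel (mul (mul a b) c) (mul (mul b a) c)
  -- derivation
  | diff_add (a b) : FreePermDer.Rel (diff (add a b)) (add (diff a) (diff b))
  | diff_smul (t : k) (a) : FreePermDer.Rel (diff (smul t a)) (smul t (diff a))
  | diff_mul (a b) :
      FreePermDer.Rel (diff (mul a b)) (add (mul (diff a) b) (mul a (diff b)))
  -- congruence
  | add_congr_left (a) {b c} : FreePermDer.Rel b c → FreePermDer.Rel (add a b) (add a c)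
  | add_congr_right {a b} (c) : FreePermDer.Rel a b → FreePermDer.Rel (add a c) (add b c)
  | smul_congr (t : k) {a b} : FreePermDer.Rel a b → FreePermDer.Rel (smul t a) (smul t b)
  | mul_congr_left (a) {b c} : FreePermDer.Rel b c → FreePermDer.Rel (mul a b) (mul a c)
  | mul_congr_right {a b} (c) : FreePermDer.Rel a b → FreePermDer.Rel (mul a c) (mul b c)
  | diff_congr {a b} : FreePermDer.Rel a b → FreePermDer.Rel (diff a) (diff b)

/-- The free differential Perm-algebra over `k` generated by the set `X`. -/
def FreePermDer : Type (max u v) := Quot (FreePermDer.Rel k X)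

namespace FreePermDer

variable {k X}

instance : SMul k (FreePermDer k X) where
  smul t := Quot.map (Term.smul t) fun _ _ => Rel.smul_congr t

instance : Zero (FreePermDer k X) where
  zero := Quot.mk _ Term.zero

instance : Add (FreePermDer k X) where
  add := Quot.map₂ Term.add (fun _ _ _ => Rel.add_congr_left _)
    fun _ _ _ => Rel.add_congr_right _

instance : Mul (FreePermDer k X) where
  mul := Quot.map₂ Term.mul (fun _ _ _ => Rel.mul_congr_left _)
    fun _ _ _ => Rel.mul_congr_right _

instance : Neg (FreePermDer k X) where
  neg a := (-1 : k) • a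

theorem add_assoc_aux (a b c : FreePermDer k X) : a + b + c = a + (b + c) := by
  obtain ⟨a⟩ := a; obtain ⟨b⟩ := b; obtain ⟨c⟩ := c
  exact Quot.sound (Rel.add_assoc a b c)

theorem add_comm_aux (a b : FreePermDer k X) : a + b = b + a := by
  obtain ⟨a⟩ := a; obtain ⟨b⟩ := b
  exact Quot.sound (Rel.add_comm a b)

theorem zero_add_aux (a : FreePermDer k X) : 0 + a = a := by
  obtain ⟨a⟩ := a
  exact Quot.sound (Rel.zero_add a)

theorem add_smul_aux (s t : k) (a : FreePermDer k X) : (s + t) • a = s • a + t • a := by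
  obtain ⟨a⟩ := a
  exact Quot.sound (Rel.add_smul s t a)

theorem smul_smul_aux (s t : k) (a : FreePermDer k X) : (s * t) • a = s • t • a := by
  obtain ⟨a⟩ := a
  exact Quot.sound (Rel.smul_smul s t a)

theorem one_smul_aux (a : FreePermDer k X) : (1 : k) • a = a := by
  obtain ⟨a⟩ := a
  exact Quot.sound (Rel.one_smul a)

theorem zero_smul_aux (a : FreePermDer k X) : (0 : k) • a = 0 := by
  obtain ⟨a⟩ := a
  exact Quot.sound (Rel.zero_smul a)

instance : AddCommGroup (FreePermDer k X) where
  add_assoc := add_assoc_aux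
  zero_add := zero_add_aux
  add_zero a := by rw [add_comm_aux, zero_add_aux]
  add_comm := add_comm_aux
  nsmul := nsmulRec
  zsmul := zsmulRec
  neg_add_cancel a := by
    change (-1 : k) • a + a = 0
    conv_lhs => rw [← one_smul_aux a]
    rw [← smul_smul_aux, ← add_smul_aux, mul_one, neg_add_cancel, zero_smul_aux]

instance : Module k (FreePermDer k X) where
  one_smul := one_smul_aux
  mul_smul := smul_smul_aux
  add_smul := add_smul_aux
  zero_smul := zero_smul_aux
  smul_add t := by rintro ⟨a⟩ ⟨b⟩; exact Quot.sound (Rel.smul_add t a b)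
  smul_zero t := by
    rw [← zero_smul_aux (0 : FreePermDer k X), ← smul_smul_aux, mul_zero]

theorem smul_mul_aux (t : k) (a b : FreePermDer k X) : (t • a) * b = t • (a * b) := by
  obtain ⟨a⟩ := a; obtain ⟨b⟩ := b
  exact Quot.sound (Rel.smul_mul t a b)

theorem mul_smul_aux (t : k) (a b : FreePermDer k X) : a * (t • b) = t • (a * b) := by
  obtain ⟨a⟩ := a; obtain ⟨b⟩ := b
  exact Quot.sound (Rel.mul_smul t a b)

instance : PermRing (FreePermDer k X) where
  left_distrib := by rintro ⟨a⟩ ⟨b⟩ ⟨c⟩; exact Quot.sound (Rel.left_distrib a b c)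
  right_distrib := by rintro ⟨a⟩ ⟨b⟩ ⟨c⟩; exact Quot.sound (Rel.right_distrib a b c)
  zero_mul a := by
    rw [← zero_smul k (0 : FreePermDer k X), smul_mul_aux, zero_smul, zero_smul]
  mul_zero a := by
    rw [← zero_smul k (0 : FreePermDer k X), mul_smul_aux, zero_smul, zero_smul]
  mul_assoc := by rintro ⟨a⟩ ⟨b⟩ ⟨c⟩; exact Quot.sound (Rel.mul_assoc a b c)
  mul_left_comm' := by rintro ⟨a⟩ ⟨b⟩ ⟨c⟩; exact Quot.sound (Rel.mul_left_comm a b c)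

instance : DiffPermAlgebra k (FreePermDer k X) where
  smul_assoc := smul_mul_aux
  smul_comm t a b := (mul_smul_aux t a b).symm
  diff' :=
    { toFun := Quot.map Term.diff fun _ _ => Rel.diff_congr
      map_add' := by rintro ⟨a⟩ ⟨b⟩; exact Quot.sound (Rel.diff_add a b)
      map_smul' := by rintro t ⟨a⟩; exact Quot.sound (Rel.diff_smul t a) }
  leibniz' := by rintro ⟨a⟩ ⟨b⟩; exact Quot.sound (Rel.diff_mul a b)

variable (k)

/-- The free generators. -/
def of (x : X) : FreePermDer k X := Quot.mk _ (Term.of x)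

variable {k}

/-- Evaluation of a formal term in a differential Perm-algebra. -/
def Term.eval {P : Type w} [PermRing P] [DiffPermAlgebra k P] (f : X → P) : Term k X → P
  | .of x => f x
  | .zero => 0
  | .add a b => a.eval f + b.eval f
  | .smul t a => t • a.eval f
  | .mul a b => a.eval f * b.eval f
  | .diff a => DiffPermAlgebra.diff k (a.eval f)

variable (k)

/-- The universal property of the free differential Perm-algebra. -/
theorem existsUnique_lift {P : Type w} [PermRing P] [DiffPermAlgebra k P] (f : X → P) :
    ∃! φ : FreePermDer k X →ₙₐ[k] P, (∀ x, φ (of k x) = f x) ∧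
      ∀ a, φ (DiffPermAlgebra.diff k a) = DiffPermAlgebra.diff k (φ a) := by
  have hF : ∀ a b : Term k X, Rel k X a b → a.eval f = b.eval f := by
    intro a b h
    induction h with
    | add_comm a b => exact _root_.add_comm _ _
    | add_assoc a b c => exact _root_.add_assoc _ _ _
    | zero_add a => exact _root_.zero_add _
    | smul_add t a b => exact _root_.smul_add _ _ _
    | add_smul s t a => exact _root_.add_smul _ _ _
    | smul_smul s t a => exact SemigroupAction.mul_smul _ _ _
    | one_smul a => exact _root_.one_smul _ _
    | zero_smul a => exact _root_.zero_smul _ _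
    | left_distrib a b c => exact mul_add _ _ _
    | right_distrib a b c => exact add_mul _ _ _
    | smul_mul t a b => exact smul_mul_assoc _ _ _
    | mul_smul t a b => exact mul_smul_comm _ _ _
    | mul_assoc a b c => exact _root_.mul_assoc _ _ _
    | mul_left_comm a b c => exact PermRing.mul_left_comm' _ _ _
    | diff_add a b => exact map_add _ _ _
    | diff_smul t a => exact map_smul _ _ _
    | diff_mul a b => exact DiffPermAlgebra.diff_mul k _ _
    | add_congr_left a _ ih => simp only [Term.eval, ih]
    | add_congr_right c _ ih => simp only [Term.eval, ih]
    | smul_congr t _ ih => simp only [Term.eval, ih]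
    | mul_congr_left a _ ih => simp only [Term.eval, ih]
    | mul_congr_right c _ ih => simp only [Term.eval, ih]
    | diff_congr _ ih => simp only [Term.eval, ih]
  refine ⟨{ toFun := fun c => Quot.liftOn c (Term.eval f) hF
            map_smul' := ?_, map_zero' := rfl, map_add' := ?_, map_mul' := ?_ }, ⟨?_, ?_⟩, ?_⟩
  · rintro t ⟨a⟩; rfl
  · rintro ⟨a⟩ ⟨b⟩; rfl
  · rintro ⟨a⟩ ⟨b⟩; rfl
  · intro x; rfl
  · rintro ⟨a⟩; rfl
  · rintro ψ ⟨hψ, hd⟩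
    let mk : Term k X → FreePermDer k X := Quot.mk (Rel k X)
    ext ⟨a⟩
    change ψ (mk a) = a.eval f
    induction a with
    | of x => exact hψ x
    | zero => exact map_zero ψ
    | add a b iha ihb =>
      exact (map_add ψ (mk a) (mk b)).trans (congrArg₂ (· + ·) iha ihb)
    | smul t a ih => exact (map_smul ψ t (mk a)).trans (congrArg (t • ·) ih)
    | mul a b iha ihb =>
      exact (map_mul ψ (mk a) (mk b)).trans (congrArg₂ (· * ·) iha ihb)
    | diff a ih => exact (hd (mk a)).trans (congrArg (DiffPermAlgebra.diff k) ih)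

end FreePermDer

end FreePermDer

/-! ### The derived product -/

/-- The vector space of a differential Perm-algebra `P`, with the product `f ∘ g = f d(g)`. -/
def DerivedAlgebra (k : Type u) [Field k] (P : Type w) [PermRing P] [DiffPermAlgebra k P] :
    Type w := P

namespace DerivedAlgebra

variable {k : Type u} [Field k] {P : Type w} [PermRing P] [DiffPermAlgebra k P]

instance : AddCommGroup (DerivedAlgebra k P) := inferInstanceAs (AddCommGroup P)

instance : Module k (DerivedAlgebra k P) := inferInstanceAs (Module k P)

variable (k) in
/-- The identity map from `P` to `P` with the product `f ∘ g = f d(g)`. -/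
def toDerived : P ≃ₗ[k] DerivedAlgebra k P := LinearEquiv.refl k P

instance : Mul (DerivedAlgebra k P) where
  mul f g := toDerived k
    ((toDerived k).symm f * DiffPermAlgebra.diff k ((toDerived k).symm g))

theorem mul_def (f g : DerivedAlgebra k P) :
    f * g = toDerived k
      ((toDerived k).symm f * DiffPermAlgebra.diff k ((toDerived k).symm g)) := rfl

instance : NonUnitalNonAssocRing (DerivedAlgebra k P) where
  left_distrib a b c := by simp only [mul_def, map_add, mul_add]
  right_distrib a b c := by simp only [mul_def, map_add, add_mul]
  zero_mul a := by simp only [mul_def, map_zero, zero_mul]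
  mul_zero a := by simp only [mul_def, map_zero, mul_zero]

instance : IsScalarTower k (DerivedAlgebra k P) (DerivedAlgebra k P) where
  smul_assoc t a b := by simp only [smul_eq_mul, mul_def, map_smul, smul_mul_assoc]

instance : SMulCommClass k (DerivedAlgebra k P) (DerivedAlgebra k P) where
  smul_comm t a b := by simp only [smul_eq_mul, mul_def, map_smul, mul_smul_comm]

end DerivedAlgebra

/-- A left-symmetric algebra `A` over `k` is special if it embeds into a differential
Perm-algebra `P` over `k` so that `a * b` becomes `a d(b)`. -/
def IsSpecial (k : Type u) [Field k] (A : Type w) [LeftPreLieRing A] [LeftPreLieAlgebra k A] :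
    Prop :=
  ∃ (P : Type (max u w)) (_ : PermRing P) (_ : DiffPermAlgebra k P)
    (j : A →ₙₐ[k] DerivedAlgebra k P), Function.Injective j

/-- The subalgebra generated by `X` in the free differential Perm-algebra on `X`
relative to the operation `f ∘ g = f d(g)`. -/
def derivedSubalgebra (k : Type u) [Field k] (X : Type v) :
    NonUnitalSubalgebra k (DerivedAlgebra k (FreePermDer k X)) :=
  NonUnitalAlgebra.adjoin k
    (Set.range fun x : X => DerivedAlgebra.toDerived k (FreePermDer.of k x))

end

/-!
The isomorphism is the homomorphism determined by `x ↦ x`; its image is the subalgebra generated by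
`X`, so the content of the theorem is injectivity.

In a left-symmetric ring the symmetric braces `⟨a₁, …, aₙ; y⟩` are defined by
`⟨c, a₁, …, aₙ; y⟩ = c * ⟨a₁, …, aₙ; y⟩ - ∑ᵢ ⟨a₁, …, c * aᵢ, …, aₙ; y⟩` (`brace`, `brace_perm`).
For the product `a * b = a d(b)` they are `a₁ ⋯ aₙ dⁿ(y)` (`map_brace`). Iterated braces of
generators are
indexed by rooted trees labelled by `X`. In a differential Perm-algebra such a tree becomes a
monomial that remembers only the label and the number of children of each vertex, and which vertex
is the root. So it has to be shown that in an SLS-ring, too, trees with the same such data have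
the same value.

The two identities of SLS-rings give two moves on trees: an argument of a vertex may be exchanged
with an argument of its parent (`argSwap`), and two nested vertices below another vertex may be
exchanged (`brace_nested_cons`). For trees with at most four vertices the moves are the identities
of an SLS-ring. In general the two families are proved by one induction on the number of arguments
involved (`argSwap_and_vertexSwap`): multiplying a known identity by an element `c` from the left
adds `c` as an argument at every vertex, and the unwanted terms are handled by the other family.

By the moves, every tree can be brought to the form of a chain, in which every vertex has at most
one child that is not a leaf: the chains of generators span the subalgebra they generate
(`mul_mem_chainSpan`). Also by the moves, the value of a chain depends only on the root, the
multiset of the other vertices and the multiset of leaves (`chain_cons_perm`). Finally, the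
monomials of chains are computed in a differential Perm-algebra of polynomials (`PermModel`), with
product `f g = π(f) g` for an idempotent endomorphism `π` that forgets which letters are last. A
monomial determines the data of a chain, hence its value, so the map to polynomials has a left
inverse on the span of the chains (`injOn_chainSpan`).
-/

/-! ### Braces in a left-symmetric ring -/

section Brace

variable {A : Type*}

/-- The sum of the values of `f` at the lists obtained from `l` by replacing one entry `e` by
`c * e`: the derivation `c * ·` extended to words, followed by `f`. -/
def derivSum {M : Type*} [Mul A] [Zero M] [Add M] (c : A) : List A → (List A → M) → M
  | [], _ => 0
  | a :: l, f => f ((c * a) :: l) + derivSum c l fun l' => f (a :: l')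

section derivSum

variable {M M' : Type*} [Mul A]

theorem derivSum_congr [Zero M] [Add M] (c : A) (l : List A) {f g : List A → M}
    (h : ∀ l', l'.length = l.length → f l' = g l') : derivSum c l f = derivSum c l g := by
  induction l generalizing f g with
  | nil => rfl
  | cons a l ih =>
    simp only [derivSum]
    rw [h _ (by simp), ih fun l' hl' => h _ (by simp [hl'])]

theorem map_derivSum [AddMonoid M] [AddMonoid M'] (φ : M →+ M') (c : A) (l : List A)
    (f : List A → M) : φ (derivSum c l f) = derivSum c l fun l' => φ (f l') := by
  induction l generalizing f with
  | nil => exact map_zero φ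
  | cons a l ih => simp only [derivSum, map_add, ih]

theorem derivSum_add [AddCommMonoid M] (c : A) (l : List A) (f g : List A → M) :
    derivSum c l (fun l' => f l' + g l') = derivSum c l f + derivSum c l g := by
  induction l generalizing f g with
  | nil => simp [derivSum]
  | cons a l ih => simp only [derivSum, ih]; abel

theorem derivSum_sub [AddCommGroup M] (c : A) (l : List A) (f g : List A → M) :
    derivSum c l (fun l' => f l' - g l') = derivSum c l f - derivSum c l g := by
  induction l generalizing f g with
  | nil => simp [derivSum]
  | cons a l ih => simp only [derivSum, ih]; abel

theorem derivSum_eq_zero [AddMonoid M] (c : A) (l : List A) {f : List A → M}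
    (h : ∀ l', l'.length = l.length → f l' = 0) : derivSum c l f = 0 := by
  induction l generalizing f with
  | nil => rfl
  | cons a l ih =>
    simp only [derivSum]
    rw [h _ (by simp), ih fun l' hl' => h _ (by simp [hl']), add_zero]

theorem derivSum_perm [AddCommMonoid M] (c : A) {l₁ l₂ : List A} (hl : l₁.Perm l₂)
    {f : List A → M} (hf : ∀ l l' : List A, l.Perm l' → f l = f l') :
    derivSum c l₁ f = derivSum c l₂ f := by
  induction hl generalizing f with
  | nil => rfl
  | cons a h ih =>
    simp only [derivSum]
    rw [hf _ _ (h.cons _), ih fun l l' h' => hf _ _ (h'.cons a)]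
  | swap a b l =>
    simp only [derivSum]
    rw [hf _ _ (List.Perm.swap a (c * b) l), hf _ _ (List.Perm.swap (c * a) b l),
      ← add_assoc, ← add_assoc, add_comm (f (a :: c * b :: l))]
    congr 1
    exact derivSum_congr c l fun l' _ => hf _ _ (List.Perm.swap _ _ _)
  | trans _ _ ih₁ ih₂ => exact (ih₁ hf).trans (ih₂ hf)

/-- For symmetric functions, two sums over modified words may be compared by comparing the words
in which the modified entry comes first. -/
theorem derivSum_congr_cons [AddCommMonoid M] (c c' : A) (l : List A) {f g : List A → M}
    (hf : ∀ l l' : List A, l.Perm l' → f l = f l') (hg : ∀ l l' : List A, l.Perm l' → g l = g l')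
    (h : ∀ e o, o.length + 1 = l.length → f ((c * e) :: o) = g ((c' * e) :: o)) :
    derivSum c l f = derivSum c' l g := by
  induction l generalizing f g with
  | nil => rfl
  | cons a l ih =>
    simp only [derivSum]
    rw [h a l (by simp), ih (fun l l' hl => hf _ _ (hl.cons a)) (fun l l' hl => hg _ _ (hl.cons a))]
    intro e o ho
    rw [hf _ _ (List.Perm.swap (c * e) a o), hg _ _ (List.Perm.swap (c' * e) a o)]
    exact h e (a :: o) (by simp [ho])

end derivSum

/-- Additivity of a function on words in every entry. -/
def MultiAdd {M : Type*} [Add A] [Add M] (f : List A → M) : Prop :=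
  ∀ (l₁ : List A) (u v : A) (l₂ : List A),
    f (l₁ ++ (u + v) :: l₂) = f (l₁ ++ u :: l₂) + f (l₁ ++ v :: l₂)

section MultiAdd

variable {M : Type*} [AddCommGroup M] {f : List A → M}

theorem MultiAdd.cons [Add A] (hf : MultiAdd f) (a : A) : MultiAdd fun l => f (a :: l) :=
  fun l₁ u v l₂ => hf (a :: l₁) u v l₂

theorem MultiAdd.comp_derivSum [NonUnitalNonAssocRing A] (hf : MultiAdd f) (c : A) :
    MultiAdd fun l => derivSum c l f := by
  intro l₁ u v l₂
  induction l₁ generalizing f with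
  | nil =>
    simp only [List.nil_append, derivSum, mul_add]
    rw [← add_add_add_comm, ← derivSum_add]
    exact congrArg₂ (· + ·) (hf [] _ _ _) (derivSum_congr c l₂ fun l' _ => hf [] _ _ _)
  | cons a l₁ ih =>
    exact (congrArg₂ (· + ·) (hf (c * a :: l₁) u v l₂) (ih (hf.cons a))).trans
      (add_add_add_comm _ _ _ _)

theorem MultiAdd.derivSum_add_left [NonUnitalNonAssocRing A] (hf : MultiAdd f) (c c' : A)
    (l : List A) : derivSum (c + c') l f = derivSum c l f + derivSum c' l f := by
  induction l generalizing f with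
  | nil => simp [derivSum]
  | cons a l ih =>
    simp only [derivSum, add_mul]
    rw [ih (hf.cons a), add_add_add_comm]
    exact congrArg₂ (· + ·) (hf [] _ _ _) rfl

theorem MultiAdd.derivSum_sub_left [NonUnitalNonAssocRing A] (hf : MultiAdd f) (c c' : A)
    (l : List A) : derivSum (c - c') l f = derivSum c l f - derivSum c' l f := by
  rw [eq_sub_iff_add_eq, ← hf.derivSum_add_left, sub_add_cancel]

/-- The derivations `c * ·` represent the commutator Lie ring of a left-symmetric ring. -/
theorem MultiAdd.derivSum_comm [LeftPreLieRing A] (hf : MultiAdd f) (a b : A) (l : List A) :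
    derivSum b l (fun l' => derivSum a l' f) -
      derivSum a l (fun l' => derivSum b l' f) =
        derivSum (a * b - b * a) l f := by
  induction l generalizing f with
  | nil => simp [derivSum]
  | cons e l ih =>
    have h1 : (a * b - b * a) * e + b * (a * e) = a * (b * e) := by
      have := LeftPreLieRing.assoc_symm a b e
      rw [associator_apply, associator_apply, sub_eq_sub_iff_add_eq_add] at this
      rw [sub_mul, sub_add_eq_add_sub, this]; abel
    have h2 := hf [] ((a * b - b * a) * e) (b * (a * e)) l
    simp only [List.nil_append, h1] at h2
    simp only [derivSum, derivSum_add]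
    rw [← ih (hf.cons e), h2]
    abel

end MultiAdd

section LeftPreLie

variable [LeftPreLieRing A]

/-- The recursion defining `brace`, with an explicit bound on the length of the word; words longer
than the bound are sent to `0`. -/
def braceAux : ℕ → List A → A → A
  | _, [], y => y
  | 0, _ :: _, _ => 0
  | n + 1, c :: l, y => c * braceAux n l y - derivSum c l fun l' => braceAux n l' y

theorem multiAdd_braceAux (n : ℕ) (y : A) : MultiAdd fun l => braceAux n l y := by
  induction n with
  | zero => rintro (_ | ⟨a, l₁⟩) u v l₂ <;> simp [braceAux]
  | succ n ih =>
    rintro (_ | ⟨a, l₁⟩) u v l₂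
    · simp only [List.nil_append, braceAux]
      rw [ih.derivSum_add_left, add_mul]
      abel
    · simp only [List.cons_append, braceAux]
      have h₁ := ih l₁ u v l₂
      have h₂ := ih.comp_derivSum a l₁ u v l₂
      dsimp only at h₁ h₂
      rw [h₁, h₂, mul_add]
      abel

theorem braceAux_swap (n : ℕ) (a b : A) (l : List A) (y : A)
    (ih : ∀ (m : ℕ), m < n → ∀ l l' : List A, l.Perm l' → braceAux m l y = braceAux m l' y) :
    braceAux n (a :: b :: l) y = braceAux n (b :: a :: l) y := by
  match n with
  | 0 => rfl
  | 1 =>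
    simp only [braceAux, derivSum]
    rw [derivSum_eq_zero a l fun _ _ => rfl, derivSum_eq_zero b l fun _ _ => rfl]
    simp
  | n + 2 =>
    -- The difference of the two sides vanishes by left symmetry and since the derivations `a * ·`
    -- and `b * ·` have commutator `(a * b - b * a) * ·`.
    simp only [braceAux, derivSum]
    have hm := multiAdd_braceAux n y
    have key := hm.derivSum_comm a b l
    have hl : ∀ c d, derivSum c l (fun l' => d * braceAux n l' y) =
        d * derivSum c l (fun l' => braceAux n l' y) := fun c d =>
      (map_derivSum (AddMonoidHom.mulLeft d) c l _).symm
    have hs := LeftPreLieRing.assoc_symm a b (braceAux n l y)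
    rw [associator_apply, associator_apply] at hs
    rw [derivSum_sub, derivSum_sub, hl, hl, mul_sub, mul_sub]
    rw [hm.derivSum_sub_left] at key
    generalize derivSum a l (fun l' => braceAux n l' y) = p at *
    generalize derivSum b l (fun l' => braceAux n l' y) = q at *
    generalize derivSum (a * b) l (fun l' => braceAux n l' y) = r at *
    generalize derivSum (b * a) l (fun l' => braceAux n l' y) = s at *
    generalize derivSum b l (fun l' => derivSum a l' fun l' => braceAux n l' y) = p' at *
    generalize derivSum a l (fun l' => derivSum b l' fun l' => braceAux n l' y) = q' at *
    have : p' = r - s + q' := by rw [← key]; abel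
    have hs' : a * (b * braceAux n l y) = a * b * braceAux n l y -
        (b * a * braceAux n l y - b * (a * braceAux n l y)) := by rw [← hs]; abel
    rw [this, hs']
    abel

theorem braceAux_perm (n : ℕ) (y : A) {l l' : List A} (h : l.Perm l') :
    braceAux n l y = braceAux n l' y := by
  induction n using Nat.strong_induction_on generalizing l l' with
  | _ n ih =>
    induction h with
    | nil => rfl
    | cons a h _ =>
      cases n with
      | zero => rfl
      | succ n =>
        simp only [braceAux]
        rw [ih n (Nat.lt_succ_self n) h,
          derivSum_perm a h fun l l' hl => ih n (Nat.lt_succ_self n) hl]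
    | swap a b l => exact braceAux_swap n b a l y fun m hm l l' hl => ih m hm hl
    | trans _ _ ih₁ ih₂ => exact ih₁.trans ih₂

/-- The symmetric brace `⟨a₁, …, aₙ; y⟩` of a left-symmetric ring. When the product is
`a * b = a d(b)`, it is `a₁ ⋯ aₙ d ⁿ(y)`; in the free left-symmetric ring it is the grafting of
the `aᵢ` on the vertex `y`. -/
def brace (l : List A) (y : A) : A := braceAux l.length l y

@[simp] theorem brace_nil (y : A) : brace [] y = y := rfl

theorem brace_cons (c : A) (l : List A) (y : A) :
    brace (c :: l) y = c * brace l y - derivSum c l fun l' => brace l' y := by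
  simp only [brace, List.length_cons, braceAux]
  rw [derivSum_congr c l fun l' hl' => by rw [← hl']]

theorem mul_brace (c : A) (l : List A) (y : A) :
    c * brace l y = brace (c :: l) y + derivSum c l fun l' => brace l' y := by
  rw [brace_cons, sub_add_cancel]

theorem brace_perm {l l' : List A} (h : l.Perm l') (y : A) : brace l y = brace l' y := by
  rw [brace, brace, h.length_eq, braceAux_perm _ _ h]

theorem brace_swap (a b : A) (l : List A) (y : A) :
    brace (a :: b :: l) y = brace (b :: a :: l) y :=
  brace_perm (List.Perm.swap _ _ _) y

@[simp] theorem brace_singleton (a y : A) : brace [a] y = a * y := by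
  simp [brace_cons, derivSum]

theorem brace_pair (a b y : A) : brace [a, b] y = a * (b * y) - (a * b) * y := by
  simp [brace_cons a [b], derivSum]

theorem brace_add_cons (u v : A) (l : List A) (y : A) :
    brace ((u + v) :: l) y = brace (u :: l) y + brace (v :: l) y := by
  simp only [brace, List.length_cons]
  exact multiAdd_braceAux _ y [] u v l

/-- `brace` as an additive function of its first argument. -/
def braceHom (l : List A) (y : A) : A →+ A :=
  AddMonoidHom.mk' (fun u => brace (u :: l) y) fun u v => brace_add_cons u v l y

theorem braceHom_apply (l : List A) (y u : A) : braceHom l y u = brace (u :: l) y := rfl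

theorem brace_zero_cons (l : List A) (y : A) : brace (0 :: l) y = 0 :=
  map_zero (braceHom l y)

theorem brace_sub_cons (u v : A) (l : List A) (y : A) :
    brace ((u - v) :: l) y = brace (u :: l) y - brace (v :: l) y :=
  map_sub (braceHom l y) u v

theorem brace_derivSum_cons (c : A) (s : List A) (f : List A → A) (l : List A) (y : A) :
    brace (derivSum c s f :: l) y = derivSum c s fun s' => brace (f s' :: l) y :=
  map_derivSum (braceHom l y) c s f

theorem derivSum_mul (c : A) (s : List A) (f : List A → A) (w : A) :
    derivSum c s f * w = derivSum c s fun s' => f s' * w :=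
  map_derivSum (AddMonoidHom.mulRight w) c s f

/-- The value of a brace in terms of an additive map to a commutative differential ring. -/
theorem map_brace {R : Type*} [CommRing R] (π : R →+* R) (d : Derivation ℤ R R)
    (hπ : ∀ r, π (π r) = π r) (hd : ∀ r, π (d r) = d (π r)) (g : A →+ R)
    (hg : ∀ a b, g (a * b) = π (g a) * d (g b)) (l : List A) (y : A) :
    g (brace l y) = (l.map fun a => π (g a)).prod * d^[l.length] (g y) := by
  have hD : ∀ (c : A) (l : List A) (Y : R),
      derivSum c l (fun l' => (l'.map fun a => π (g a)).prod * Y) =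
        π (g c) * d (l.map fun a => π (g a)).prod * Y := by
    intro c l
    induction l with
    | nil => simp [derivSum]
    | cons a l ih =>
      intro Y
      have h1 : ∀ l' : List A, ((a :: l').map fun a => π (g a)).prod * Y =
          (l'.map fun a => π (g a)).prod * (π (g a) * Y) := fun l' => by
        rw [List.map_cons, List.prod_cons]; ring
      simp only [derivSum, h1]
      rw [ih]
      simp only [List.map_cons, List.prod_cons, hg, map_mul, hπ, hd, Derivation.leibniz,
        smul_eq_mul]
      ring
  induction hn : l.length generalizing l with
  | zero => simp [List.length_eq_zero_iff.mp hn]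
  | succ n ih =>
    obtain ⟨c, l, rfl⟩ := List.exists_cons_of_length_eq_add_one hn
    have hl : l.length = n := by simpa using hn
    rw [brace_cons, map_sub, map_derivSum, hg, ih l hl,
      derivSum_congr c l fun l' hl' => ih l' (hl'.trans hl), hD, Function.iterate_succ_apply',
      List.map_cons, List.prod_cons, Derivation.leibniz]
    simp only [smul_eq_mul]
    ring

theorem brace_smul_cons {k : Type*} [CommRing k] [LeftPreLieAlgebra k A] (t : k) (u : A)
    (l : List A) (y : A) : brace ((t • u) :: l) y = t • brace (u :: l) y := by
  induction hn : l.length generalizing l u with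
  | zero => simp [List.length_eq_zero_iff.mp hn, smul_mul_assoc]
  | succ n ih =>
    obtain ⟨c, l, rfl⟩ := List.exists_cons_of_length_eq_add_one hn
    have hl : l.length = n := by simpa using hn
    have h (a : A) : brace (a :: c :: l) y = c * brace (a :: l) y -
        (brace ((c * a) :: l) y + derivSum c l fun l' => brace (a :: l') y) := by
      rw [brace_swap, brace_cons]; rfl
    rw [h, h, mul_smul_comm, ih u l hl, ih (c * u) l hl, mul_smul_comm,
      derivSum_congr c l fun l' hl' => ih u l' (hl'.trans hl), smul_sub, smul_add]
    congr 2
    exact (map_derivSum (DistribSMul.toAddMonoidHom A t) c l _).symm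

end LeftPreLie

end Brace

/-! ### Brace identities in SLS-rings -/

section SLSBrace

variable {A : Type*}

section LeftPreLie

variable [LeftPreLieRing A]

theorem mul_brace_cons (c u : A) (l : List A) (y : A) :
    c * brace (u :: l) y = brace (u :: c :: l) y + brace ((c * u) :: l) y +
      derivSum c l fun l' => brace (u :: l') y := by
  rw [mul_brace, brace_swap, derivSum, add_assoc]

/-- The difference of two nested braces in which the inner and the outer vertex, with all their
arguments but `x`, are exchanged. -/
def nestedDefect (r t : List A) (x z y : A) : A :=
  brace (brace (x :: t) y :: r) z - brace (brace (x :: r) z :: t) y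

theorem nestedDefect_symm (r t : List A) (x z y : A) :
    nestedDefect r t x z y = -nestedDefect t r x y z :=
  (neg_sub _ _).symm

theorem mul_nestedDefect (c : A) (r t : List A) (x z y : A) :
    c * nestedDefect r t x z y =
      nestedDefect (c :: r) t x z y + nestedDefect r (c :: t) x z y +
        nestedDefect r t (c * x) z y + derivSum c r (fun r' => nestedDefect r' t x z y) +
          derivSum c t (fun t' => nestedDefect r t' x z y) := by
  have h (r t : List A) (z y : A) : c * brace (brace (x :: t) y :: r) z =
      brace (brace (x :: t) y :: c :: r) z + brace (brace (x :: c :: t) y :: r) z +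
        brace (brace ((c * x) :: t) y :: r) z +
          derivSum c t (fun t' => brace (brace (x :: t') y :: r) z) +
            derivSum c r (fun r' => brace (brace (x :: t) y :: r') z) := by
    rw [mul_brace_cons, mul_brace_cons, brace_add_cons, brace_add_cons, brace_derivSum_cons]
    abel
  simp only [nestedDefect, mul_sub, h, derivSum_sub]
  abel

/-- An argument of an inner vertex may be exchanged with an argument of the outer vertex. Here `s`
and `l` are the remaining arguments of the inner and of the outer vertex. -/
def ArgSwap (l s : List A) : Prop :=
  ∀ a b z y : A, brace (brace (a :: s) z :: b :: l) y = brace (brace (b :: s) z :: a :: l) y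

/-- Nested vertices may be exchanged in the left factor of a product. -/
def VertexSwap (r t : List A) : Prop :=
  ∀ x z y w : A, nestedDefect r t x z y * w = 0

/-- Further arguments of the outer vertex come from left multiplications. -/
theorem ArgSwap.of_nil {n : ℕ} (h : ∀ s : List A, s.length ≤ n → ArgSwap [] s) (l s : List A)
    (hn : l.length + s.length ≤ n) : ArgSwap l s := by
  induction hm : l.length generalizing l s with
  | zero =>
    obtain rfl := List.length_eq_zero_iff.mp hm
    exact h s (by simpa using hn)
  | succ m ih =>
    obtain ⟨c, l, rfl⟩ := List.exists_cons_of_length_eq_add_one hm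
    simp only [List.length_cons] at hn hm
    -- Both sides are expanded by applying `c * ·` to the identity for `l`.
    have key (a b z y : A) : brace (brace (a :: s) z :: b :: c :: l) y =
        c * brace (brace (a :: s) z :: b :: l) y - brace (brace (a :: c :: s) z :: b :: l) y -
          brace (brace ((c * a) :: s) z :: b :: l) y -
            derivSum c s (fun s' => brace (brace (a :: s') z :: b :: l) y) -
              brace (brace (a :: s) z :: (c * b) :: l) y -
                derivSum c l (fun l' => brace (brace (a :: s) z :: b :: l') y) := by
      rw [mul_brace_cons c (brace (a :: s) z), mul_brace_cons c a, brace_add_cons, brace_add_cons,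
        brace_derivSum_cons, derivSum, brace_perm ((List.Perm.swap c b l).cons _)]
      abel
    intro a b z y
    have e₁ := ih l s (by omega) (by omega)
    have e₂ := ih l (c :: s) (by simp only [List.length_cons]; omega) (by omega)
    rw [key, key, e₁ a b, e₂ a b, e₁ (c * a) b, e₁ a (c * b),
      derivSum_congr c s fun s' hs' => ih l s' (by omega) (by omega) a b z y,
      derivSum_congr c l fun l' hl' => ih l' s (by omega) (by omega) a b z y]
    abel

theorem brace_nestedDefect_cons {n : ℕ}
    (h : ∀ r t : List A, r.length + t.length ≤ n → VertexSwap r t) (l r t : List A)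
    (hn : l.length + (r.length + t.length) ≤ n) (x z y w : A) :
    brace (nestedDefect r t x z y :: l) w = 0 := by
  induction hm : l.length generalizing l r t x with
  | zero =>
    obtain rfl := List.length_eq_zero_iff.mp hm
    rw [brace_singleton]
    exact h r t (by simpa using hn) x z y w
  | succ m ih =>
    obtain ⟨c, l, rfl⟩ := List.exists_cons_of_length_eq_add_one hm
    simp only [List.length_cons] at hn hm
    have key := mul_brace_cons c (nestedDefect r t x z y) l w
    rw [mul_nestedDefect, brace_add_cons, brace_add_cons, brace_add_cons, brace_add_cons,
      brace_derivSum_cons, brace_derivSum_cons, ih l r t (by omega) _ (by omega),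
      ih l (c :: r) t (by simp only [List.length_cons]; omega) _ (by omega),
      ih l r (c :: t) (by simp only [List.length_cons]; omega) _ (by omega),
      ih l r t (by omega) _ (by omega),
      derivSum_eq_zero c r fun r' hr' => ih l r' t (by omega) _ (by omega),
      derivSum_eq_zero c t fun t' ht' => ih l r t' (by omega) _ (by omega),
      derivSum_eq_zero c l fun l' hl' => ih l' r t (by omega) _ (by omega)] at key
    simpa using key.symm

/-- For defects with at least one further argument, argument exchange alone yields vertex exchange
below a vertex `w` with one further child `c`: permuting `c`, `a` and `x` moves `c` to the bottom
and `x` to the top, and two more argument exchanges move them back while reversing the nesting. -/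
theorem brace_pair_nestedDefect_of_argSwap {n : ℕ}
    (h : ∀ l s : List A, l.length + s.length ≤ n → ArgSwap l s) (a : A) (r t : List A)
    (hn : r.length + t.length + 1 ≤ n) (c x z y w : A) :
    brace [c, nestedDefect (a :: r) t x z y] w = 0 := by
  have h₁ : ArgSwap [] (a :: r) := h _ _ (by simp only [List.length_cons, List.length_nil]; omega)
  have h₂ : ArgSwap r t := h _ _ (by omega)
  have h₃ : ArgSwap [] t := h _ _ (by simp only [List.length_nil]; omega)
  -- The arguments `c`, `a`, `x` may be permuted; only the transpositions below are needed.
  have hca (c a x : A) : brace [brace (brace (x :: t) y :: a :: r) z, c] w =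
      brace [brace (brace (x :: t) y :: c :: r) z, a] w := by
    have := h (l := []) (s := brace (x :: t) y :: r)
      (by simp only [List.length_cons, List.length_nil]; omega) a c z w
    rwa [brace_swap a, brace_swap c] at this
  have hax (c a x : A) : brace [brace (brace (x :: t) y :: a :: r) z, c] w =
      brace [brace (brace (a :: t) y :: x :: r) z, c] w := by
    rw [h₂ x a y z]
  rw [brace_swap, nestedDefect, brace_sub_cons, sub_eq_zero, hca, hax, hca, h₁, brace_swap,
    h₃ c, brace_swap]

end LeftPreLie

variable [SLSRing A]

theorem mul_mul_mul_right_comm (x y z u : A) : ((x * y) * z) * u = ((x * z) * y) * u :=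
  SLSRing.mul_mul_mul_comm' x y z u

theorem argSwap_nil_nil : ArgSwap ([] : List A) [] := by
  intro a b z y
  have h := SLSRing.associator_mul_comm' b a z y
  have h' := LeftPreLieRing.assoc_symm a (b * z) y
  have h₂ := LeftPreLieRing.assoc_symm b (a * z) y
  simp only [associator_apply] at h h' h₂
  simp only [brace_singleton, brace_pair]
  rw [← neg_sub (a * z * b * y), ← neg_sub (b * z * a * y), ← h₂, h, h']

theorem brace_mul_nestedDefect_cons_of_vertexSwap {n : ℕ}
    (h : ∀ r t : List A, r.length + t.length ≤ n → VertexSwap r t) (o : List A)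
    (ho : o.length ≤ n) (x y z w : A) :
    brace (((x * y) * z) :: o) w = brace (((x * z) * y) :: o) w := by
  have := brace_nestedDefect_cons h o [] [] (by simpa using ho) x z y w
  rwa [nestedDefect, brace_sub_cons, sub_eq_zero, brace_singleton, brace_singleton,
    brace_singleton, brace_singleton] at this

/-- One of the arguments of `z`, here `a`, is exchanged with the argument `x` of `y`, after which
`a` can be split off from the brace by its recursion. -/
theorem VertexSwap.cons_nil {n : ℕ}
    (h₁ : ∀ l s : List A, l.length + s.length ≤ n → ArgSwap l s)
    (h₂ : ∀ r t : List A, r.length + t.length ≤ n → VertexSwap r t) (a : A) (r : List A)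
    (hr : r.length ≤ n) : VertexSwap (a :: r) [] := by
  intro x z y w
  have e := h₁ r [] (by simpa using hr) x a y z
  rw [brace_singleton, brace_singleton] at e
  rw [nestedDefect, sub_mul, sub_eq_zero, brace_singleton, brace_singleton, e,
    brace_cons (a * y), brace_swap x a, brace_cons a (x :: r), sub_mul, sub_mul, sub_mul,
    mul_mul_mul_right_comm a y]
  congr 1
  -- The modified entry is moved to the front, where the factor `y` can be split off.
  rw [derivSum_mul, derivSum_mul, derivSum_mul]
  refine derivSum_congr_cons _ _ _ (fun l l' hl => by rw [brace_perm hl])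
    (fun l l' hl => by rw [brace_perm hl]) fun e o ho => ?_
  have hon : o.length ≤ n := by simp only [List.length_cons] at ho; omega
  have e₁ := h₂ o [] (by simpa using hon) (a * e) z y w
  rw [nestedDefect, sub_mul, sub_eq_zero, brace_singleton, brace_singleton] at e₁
  rw [← e₁, brace_mul_nestedDefect_cons_of_vertexSwap h₂ o hon]

theorem brace_pair_nestedDefect {n : ℕ}
    (h₁ : ∀ l s : List A, l.length + s.length ≤ n → ArgSwap l s)
    (h₂ : ∀ r t : List A, r.length + t.length ≤ n → VertexSwap r t) (r t : List A)
    (hn : r.length + t.length = n) (c x z y w : A) :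
    brace [c, nestedDefect r t x z y] w = 0 := by
  match r, t with
  | [], [] =>
    have h₃ := VertexSwap.cons_nil h₁ h₂ c [] (by simp)
    have e : nestedDefect [] [c] x z y * w = 0 := by
      rw [nestedDefect_symm, neg_mul, h₃, neg_zero]
    rw [brace_pair, h₂ [] [] (by simp), mul_nestedDefect, add_mul, add_mul, add_mul, add_mul,
      h₃, e, h₂ [] [] (by simp)]
    simp [derivSum]
  | a :: r, t =>
    exact brace_pair_nestedDefect_of_argSwap h₁ a r t
      (by simp only [List.length_cons] at hn; omega) c x z y w
  | [], b :: t =>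
    have := brace_pair_nestedDefect_of_argSwap h₁ b t []
      (by simp only [List.length_cons, List.length_nil] at hn ⊢; omega) c x y z w
    rw [nestedDefect_symm, brace_swap, ← braceHom_apply, map_neg, braceHom_apply, brace_swap,
      this, neg_zero]

/-- Arguments are moved one at a time from the vertex `y` to the vertex `z`, at the cost of a sign:
`c * nestedDefect r t` differs from `nestedDefect (c :: r) t + nestedDefect r (c :: t)` by terms
already covered. -/
theorem VertexSwap.succ {n : ℕ}
    (h₁ : ∀ l s : List A, l.length + s.length ≤ n → ArgSwap l s)
    (h₂ : ∀ r t : List A, r.length + t.length ≤ n → VertexSwap r t) (r t : List A)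
    (hn : r.length + t.length = n + 1) : VertexSwap r t := by
  induction t generalizing r with
  | nil =>
    obtain ⟨a, r, rfl⟩ := List.exists_cons_of_length_eq_add_one (by simpa using hn)
    exact VertexSwap.cons_nil h₁ h₂ a r
      (by simp only [List.length_cons, List.length_nil] at hn; omega)
  | cons c t ih =>
    intro x z y w
    simp only [List.length_cons] at hn
    have key : (c * nestedDefect r t x z y) * w = 0 := by
      have := brace_pair_nestedDefect h₁ h₂ r t (by omega) c x z y w
      rwa [brace_pair, h₂ r t (by omega), mul_zero, zero_sub, neg_eq_zero] at this
    rw [mul_nestedDefect, add_mul, add_mul, add_mul, add_mul, derivSum_mul, derivSum_mul,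
      derivSum_eq_zero c r fun r' hr' => h₂ r' t (by omega) _ _ _ _,
      derivSum_eq_zero c t fun t' ht' => h₂ r t' (by omega) _ _ _ _,
      ih (c :: r) (by simp only [List.length_cons]; omega), h₂ r t (by omega)] at key
    simpa using key

/-- `ArgSwap [] []` for the vertex `brace s b` exchanges `a` and `c` in products `a * brace s b`;
this leaves the terms in which `a` or `c` multiplies an entry of `s`. -/
theorem ArgSwap.succ_nil {n : ℕ}
    (h₁ : ∀ l s : List A, l.length + s.length ≤ n → ArgSwap l s)
    (h₂ : ∀ r t : List A, r.length + t.length ≤ n → VertexSwap r t) (s : List A)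
    (hn : s.length = n + 1) : ArgSwap [] s := by
  intro a c b y
  have e (a c : A) : brace [brace (a :: s) b, c] y = brace [a * brace s b, c] y -
      derivSum a s fun s' => brace [brace s' b, c] y := by
    rw [brace_cons a s, brace_sub_cons, brace_derivSum_cons]
  have e₀ := argSwap_nil_nil a c (brace s b) y
  rw [brace_singleton, brace_singleton] at e₀
  rw [e, e, e₀]
  congr 1
  refine derivSum_congr_cons _ _ _ (fun l l' hl => by rw [brace_perm hl])
    (fun l l' hl => by rw [brace_perm hl]) fun u o ho => ?_
  have e₁ := h₁ [] o (by simp only [List.length_nil]; omega) (a * u) c b y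
  have e₂ := argSwap_nil_nil a (brace (c :: o) b) u y
  rw [brace_singleton, brace_singleton] at e₂
  have e₃ := brace_pair_nestedDefect h₁ h₂ o [] (by simp only [List.length_nil]; omega) a c b u y
  rw [nestedDefect, brace_swap, brace_sub_cons, sub_eq_zero, brace_singleton,
    brace_singleton] at e₃
  rw [e₁, brace_swap, e₂, e₃]

theorem argSwap_and_vertexSwap (n : ℕ) :
    (∀ l s : List A, l.length + s.length ≤ n → ArgSwap l s) ∧
      ∀ r t : List A, r.length + t.length ≤ n → VertexSwap r t := by
  induction n with
  | zero =>
    constructor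
    · intro l s h
      obtain rfl := List.length_eq_zero_iff.mp (by omega : l.length = 0)
      obtain rfl := List.length_eq_zero_iff.mp (by omega : s.length = 0)
      exact argSwap_nil_nil
    · intro r t h x z y w
      obtain rfl := List.length_eq_zero_iff.mp (by omega : r.length = 0)
      obtain rfl := List.length_eq_zero_iff.mp (by omega : t.length = 0)
      simp only [nestedDefect, brace_singleton, sub_mul]
      rw [mul_mul_mul_right_comm, sub_self]
  | succ n ih =>
    obtain ⟨h₁, h₂⟩ := ih
    constructor
    · refine ArgSwap.of_nil fun s hs => ?_
      obtain hs | hs := Nat.le_or_eq_of_le_succ hs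
      · exact h₁ [] s (by simpa using hs)
      · exact ArgSwap.succ_nil h₁ h₂ s hs
    · intro r t h
      obtain h | h := Nat.le_or_eq_of_le_succ h
      · exact h₂ r t h
      · exact VertexSwap.succ h₁ h₂ r t h

theorem argSwap (l s : List A) : ArgSwap l s :=
  (argSwap_and_vertexSwap _).1 l s le_rfl

/-- Nested vertices may be exchanged if they are not at the root. -/
theorem brace_nested_cons (r t l : List A) (x z y w : A) :
    brace (brace (brace (x :: t) y :: r) z :: l) w =
      brace (brace (brace (x :: r) z :: t) y :: l) w := by
  rw [← sub_eq_zero, ← brace_sub_cons]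
  exact brace_nestedDefect_cons (argSwap_and_vertexSwap _).2 l r t le_rfl x z y w

end SLSBrace

/-! ### Chains -/

section Chain

variable {A : Type*}

/-- The iterated brace of a tree in which every vertex has at most one child that is not a leaf. The
entry `(z, j)` of `q` is a vertex `z` with `j` leaves; its remaining child is the chain of
the vertices after it. The leaves are taken from `m`, and the last vertex has one more leaf. Only
lists `m` of length `chainLeaves q` are meaningful, so the default value `0` does not matter. -/
def chain [LeftPreLieRing A] : List (A × ℕ) → List A → A
  | [], m => m.headD 0
  | (z, j) :: q, m => brace (chain q (m.drop j) :: m.take j) z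

/-- The number of leaves of a chain with vertices `q`. -/
def chainLeaves {B : Type*} (q : List (B × ℕ)) : ℕ := (q.map Prod.snd).sum + 1

theorem chainLeaves_cons {B : Type*} (z : B) (j : ℕ) (q : List (B × ℕ)) :
    chainLeaves ((z, j) :: q) = j + chainLeaves q := by
  simp only [chainLeaves, List.map_cons, List.sum_cons, add_assoc]

theorem chain_cons_append [LeftPreLieRing A] (z : A) (q : List (A × ℕ)) (l m : List A) :
    chain ((z, l.length) :: q) (l ++ m) = brace (chain q m :: l) z := by
  simp [chain]

variable [SLSRing A]

/-- A vertex `w` without leaves moves from the bottom of a chain to its top. -/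
theorem brace_chain_mul_cons (q : List (A × ℕ)) (a w : A) (m l : List A) (y : A) :
    brace (chain q ((a * w) :: m) :: l) y = brace ((chain q (a :: m) * w) :: l) y := by
  induction q generalizing m l y with
  | nil => rfl
  | cons p q ih =>
    obtain ⟨z, _ | i⟩ := p
    · have := brace_nested_cons [] [] l (chain q (a :: m)) w z y
      simp only [brace_singleton] at this
      simpa only [chain, List.drop_zero, List.take_zero, ih m [] z, brace_singleton] using this.symm
    · have := brace_nested_cons (chain q (m.drop i) :: m.take i) [] l a z w y
      simp only [brace_singleton] at this
      simp only [chain, List.drop_succ_cons, List.take_succ_cons]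
      rw [brace_swap, this, brace_swap]

/-- The first leaf of a chain may be exchanged with a sibling of the chain. -/
theorem brace_chain_cons_swap (q : List (A × ℕ)) (a b : A) (m l : List A) (y : A) :
    brace (chain q (b :: m) :: a :: l) y = brace (chain q (a :: m) :: b :: l) y := by
  induction q generalizing a b with
  | nil => exact brace_swap _ _ _ _
  | cons p q ih =>
    obtain ⟨w, _ | i⟩ := p
    · have := argSwap l [] (chain q (b :: m)) a w y
      simp only [brace_singleton] at this
      simp only [chain, List.drop_zero, List.take_zero, brace_singleton]
      rw [this, brace_swap, ih, brace_chain_mul_cons]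
    · have := argSwap l (chain q (m.drop i) :: m.take i) b a w y
      simp only [chain, List.drop_succ_cons, List.take_succ_cons]
      rw [brace_swap b] at this
      rw [this, brace_swap a]

theorem chain_swap (q : List (A × ℕ)) (p : List A) (a b : A) (m : List A)
    (h : (p ++ a :: b :: m).length = chainLeaves q) :
    chain q (p ++ a :: b :: m) = chain q (p ++ b :: a :: m) := by
  induction q generalizing p with
  | nil => simp [chainLeaves] at h; omega
  | cons zj q ih =>
    obtain ⟨z, j⟩ := zj
    rw [chainLeaves_cons] at h
    simp only [chain]
    obtain hj | rfl | hj := lt_trichotomy j (p.length + 1)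
    · have hj : j ≤ p.length := by omega
      rw [List.drop_append_of_le_length hj, List.drop_append_of_le_length hj,
        List.take_append_of_le_length hj, List.take_append_of_le_length hj, ih]
      simp only [List.length_append, List.length_drop, List.length_cons] at h ⊢
      omega
    · have e (a : A) (m : List A) : p ++ a :: m = (p ++ [a]) ++ m := by simp
      have e' (a : A) : p.length + 1 = (p ++ [a]).length := by simp
      rw [e a, e b]
      conv_lhs => rw [e' a, List.take_left, List.drop_left]
      conv_rhs => rw [e' b, List.take_left, List.drop_left]
      rw [brace_perm ((List.perm_append_singleton a p).cons _),
        brace_perm ((List.perm_append_singleton b p).cons _), brace_chain_cons_swap]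
    · obtain ⟨i, rfl⟩ : ∃ i, j = p.length + (i + 2) := ⟨j - p.length - 2, by omega⟩
      simp only [List.drop_append, List.take_append, Nat.add_sub_cancel_left,
        List.drop_succ_cons, List.take_succ_cons]
      rw [List.drop_eq_nil_of_le (by omega), List.take_of_length_le (by omega)]
      exact brace_perm (((List.Perm.swap _ _ _).append_left p).cons _) z

/-- The value of a chain does not depend on the distribution of its leaves. -/
theorem chain_perm_leaves (q : List (A × ℕ)) {m m' : List A} (hm : m.Perm m')
    (h : m.length = chainLeaves q) : chain q m = chain q m' := by
  suffices H : ∀ p : List A, (p ++ m).length = chainLeaves q →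
      chain q (p ++ m) = chain q (p ++ m') from H [] h
  clear h
  induction hm with
  | nil => exact fun _ _ => rfl
  | cons a _ ih =>
    intro p hp
    simpa using ih (p ++ [a]) (by simpa using hp)
  | swap a b m => exact fun p hp => chain_swap q p b a m hp
  | trans h₁ _ ih₁ ih₂ =>
    intro p hp
    rw [ih₁ p hp, ih₂ p (by rw [← hp, List.length_append, List.length_append, h₁.length_eq])]

theorem brace_chain_perm_vertices {q q' : List (A × ℕ)} (hq : q.Perm q') (m : List A)
    (h : m.length = chainLeaves q) (l : List A) (y : A) :
    brace (chain q m :: l) y = brace (chain q' m :: l) y := by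
  induction hq generalizing m l y with
  | nil => rfl
  | cons p _ ih =>
    obtain ⟨z, j⟩ := p
    rw [chainLeaves_cons] at h
    simp only [chain]
    rw [ih (m.drop j) (by rw [List.length_drop]; omega)]
  | swap p p' q =>
    obtain ⟨w, j⟩ := p
    obtain ⟨z, i⟩ := p'
    rw [chainLeaves_cons, chainLeaves_cons] at h
    obtain ⟨l₁, l₂, m, rfl, rfl, rfl⟩ : ∃ l₁ l₂ m', l₁.length = i ∧ l₂.length = j ∧
        m = l₁ ++ (l₂ ++ m') := by
      refine ⟨m.take i, (m.drop i).take j, (m.drop i).drop j, ?_, ?_, by simp⟩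
      · rw [List.length_take]; omega
      · rw [List.length_take, List.length_drop]; omega
    rw [chain_cons_append, chain_cons_append, brace_nested_cons, ← chain_cons_append,
      ← chain_cons_append]
    congr 2
    refine chain_perm_leaves _ ?_ ?_
    · rw [← List.append_assoc, ← List.append_assoc]
      exact List.perm_append_comm.append_right m
    · rw [chainLeaves_cons, chainLeaves_cons]
      simp only [List.length_append] at h ⊢
      omega
  | trans h₁ _ ih₁ ih₂ =>
    rw [ih₁ m h, ih₂ m (by rw [h, chainLeaves, chainLeaves, (h₁.map Prod.snd).sum_eq])]

/-- The value of a chain depends only on its root, on the multiset of its other vertices, and on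
the multiset of its leaves. -/
theorem chain_cons_perm (z : A) (j : ℕ) {q q' : List (A × ℕ)} (hq : q.Perm q') {m m' : List A}
    (hm : m.Perm m') (h : m.length = chainLeaves ((z, j) :: q)) :
    chain ((z, j) :: q) m = chain ((z, j) :: q') m' := by
  rw [chain_perm_leaves _ hm h]
  rw [hm.length_eq, chainLeaves_cons] at h
  exact brace_chain_perm_vertices hq _ (by rw [List.length_drop]; omega) _ z

/-! ### Chains span the subalgebra generated by their labels -/

section Span

variable (k : Type*) [Field k] [LeftPreLieAlgebra k A] {X : Type*} (f : X → A)

/-- The chain with labels `f x`, `x ∈ X`. -/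
def labelledChain (q : List (X × ℕ)) (m : List X) : A :=
  chain (q.map (Prod.map f id)) (m.map f)

/-- The span of the chains labelled by the values of `f`. -/
def chainSpan : Submodule k A :=
  Submodule.span k {a | ∃ q m, m.length = chainLeaves q ∧ labelledChain f q m = a}

variable {k f}

theorem labelledChain_cons_append (z : X) (q : List (X × ℕ)) (l m : List X) :
    labelledChain f ((z, l.length) :: q) (l ++ m) =
      brace (labelledChain f q m :: l.map f) (f z) := by
  have := chain_cons_append (f z) (q.map (Prod.map f id)) (l.map f) (m.map f)
  simpa [labelledChain] using this

theorem labelledChain_induction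
    {motive : (q : List (X × ℕ)) → (m : List X) → m.length = chainLeaves q → Prop}
    (leaf : ∀ x, motive [] [x] rfl)
    (node : ∀ (z : X) (l : List X) (q : List (X × ℕ)) (m : List X) (h : m.length = chainLeaves q),
      motive q m h → motive ((z, l.length) :: q) (l ++ m)
        (by rw [chainLeaves_cons, List.length_append, h]))
    (q : List (X × ℕ)) (m : List X) (h : m.length = chainLeaves q) : motive q m h := by
  induction q generalizing m with
  | nil =>
    obtain ⟨x, rfl⟩ := List.length_eq_one_iff.mp (h : m.length = 1)
    exact leaf x
  | cons p q ih =>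
    obtain ⟨z, j⟩ := p
    have h' := h
    rw [chainLeaves_cons] at h'
    obtain ⟨l, m, rfl, rfl⟩ : ∃ l m', l.length = j ∧ m = l ++ m' :=
      ⟨m.take j, m.drop j, by rw [List.length_take]; omega, by simp⟩
    have hm : m.length = chainLeaves q := by simpa using h'
    exact node z l q m hm (ih m hm)

theorem labelledChain_mem (q : List (X × ℕ)) (m : List X) (h : m.length = chainLeaves q) :
    labelledChain f q m ∈ chainSpan k f :=
  Submodule.subset_span ⟨q, m, h, rfl⟩

theorem chainSpan_induction {motive : (a : A) → a ∈ chainSpan k f → Prop}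
    (chain : ∀ q m (h : m.length = chainLeaves q),
      motive (labelledChain f q m) (labelledChain_mem q m h))
    (zero : motive 0 (zero_mem _))
    (add : ∀ a b ha hb, motive a ha → motive b hb → motive (a + b) (add_mem ha hb))
    (smul : ∀ (t : k) a ha, motive a ha → motive (t • a) (Submodule.smul_mem _ t ha)) {a : A}
    (ha : a ∈ chainSpan k f) : motive a ha := by
  induction ha using Submodule.span_induction with
  | mem a h => obtain ⟨q, m, h, rfl⟩ := h; exact chain q m h
  | zero => exact zero
  | add a b ha' hb' ha hb => exact add a b ha' hb' ha hb
  | smul t a ha' ha => exact smul t a ha' ha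

theorem brace_cons_mem_chainSpan {u : A} (hu : u ∈ chainSpan k f) (l : List X) (z : X) :
    brace (u :: l.map f) (f z) ∈ chainSpan k f := by
  induction hu using chainSpan_induction with
  | chain q m h =>
    rw [← labelledChain_cons_append]
    exact labelledChain_mem _ _ (by rw [chainLeaves_cons, List.length_append, h])
  | zero => rw [brace_zero_cons]; exact zero_mem _
  | add a b _ _ ha hb => rw [brace_add_cons]; exact add_mem ha hb
  | smul t a _ ha => rw [brace_smul_cons]; exact Submodule.smul_mem _ t ha

/-- A second argument that is not a leaf can be absorbed: the vertices of the chain `u` move, one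
after the other, on top of `v`, until only a leaf of `u` remains. -/
theorem brace_cons_cons_mem_chainSpan {u v : A} (hu : u ∈ chainSpan k f)
    (hv : v ∈ chainSpan k f) (l : List X) (z : X) :
    brace (u :: v :: l.map f) (f z) ∈ chainSpan k f := by
  induction hu using chainSpan_induction generalizing v with
  | chain q m h =>
    induction q, m, h using labelledChain_induction generalizing v with
    | leaf x =>
      rw [brace_swap]
      exact brace_cons_mem_chainSpan hv (x :: l) z
    | node w r q m h ih =>
      rw [labelledChain_cons_append, argSwap, brace_swap]
      exact ih (brace_cons_mem_chainSpan hv r w)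
  | zero => rw [brace_zero_cons]; exact zero_mem _
  | add a b _ _ ha hb => rw [brace_add_cons]; exact add_mem (ha hv) (hb hv)
  | smul t a _ ha => rw [brace_smul_cons]; exact Submodule.smul_mem _ t (ha hv)

theorem derivSum_mem {B M S : Type*} [Mul B] [AddMonoid M] [SetLike S M] [AddSubmonoidClass S M]
    (s : S) (c : B) (l : List B) (g : List B → M)
    (h : ∀ l₁ a l₂, l = l₁ ++ a :: l₂ → g (l₁ ++ (c * a) :: l₂) ∈ s) : derivSum c l g ∈ s := by
  induction l generalizing g with
  | nil => exact zero_mem s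
  | cons a l ih =>
    exact add_mem (h [] a l rfl) (ih _ fun l₁ b l₂ hl => h (a :: l₁) b l₂ (by rw [hl]; rfl))

theorem mul_mem_chainSpan {u v : A} (hu : u ∈ chainSpan k f) (hv : v ∈ chainSpan k f) :
    u * v ∈ chainSpan k f := by
  have hx (x : X) : u * f x ∈ chainSpan k f := by
    simpa using brace_cons_mem_chainSpan hu [] x
  induction hv using chainSpan_induction with
  | chain q m h =>
    induction q, m, h using labelledChain_induction with
    | leaf x => exact hx x
    | node z l q m h ih =>
      have hY := labelledChain_mem (k := k) (f := f) q m h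
      rw [labelledChain_cons_append, mul_brace_cons]
      refine add_mem (add_mem (brace_cons_cons_mem_chainSpan hY hu l z)
        (brace_cons_mem_chainSpan ih l z)) (derivSum_mem _ _ _ _ fun l₁ a l₂ hl => ?_)
      obtain ⟨m₁, m₂, rfl, rfl, h₂⟩ := List.map_eq_append_iff.mp hl
      obtain ⟨x, m₃, rfl, rfl, rfl⟩ := List.map_eq_cons_iff.mp h₂
      have := brace_cons_cons_mem_chainSpan hY (hx x) (m₁ ++ m₃) z
      rw [List.map_append] at this
      rwa [brace_perm (List.perm_middle.cons _)]
  | zero => rw [mul_zero]; exact zero_mem _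
  | add a b _ _ ha hb => rw [mul_add]; exact add_mem ha hb
  | smul t a _ ha => rw [mul_smul_comm]; exact Submodule.smul_mem _ t ha

theorem apply_mem_chainSpan (x : X) : f x ∈ chainSpan k f :=
  labelledChain_mem [] [x] rfl

end Span

end Chain

noncomputable section

/-! ### The derived product of a differential Perm-algebra -/

namespace DerivedAlgebra

variable {k : Type u} [Field k] {P : Type w} [PermRing P] [DiffPermAlgebra k P]

instance : SLSRing (DerivedAlgebra k P) where
  assoc_symm' x y z := by
    obtain ⟨x, rfl⟩ := (toDerived k).surjective x
    obtain ⟨y, rfl⟩ := (toDerived k).surjective y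
    obtain ⟨z, rfl⟩ := (toDerived k).surjective z
    simp only [associator_apply, mul_def, LinearEquiv.symm_apply_apply, DiffPermAlgebra.diff_mul,
      mul_add, ← mul_assoc, ← map_sub, sub_add_cancel_left]
    rw [PermRing.mul_left_comm' x y]
  mul_mul_mul_comm' x y z t := by
    obtain ⟨x, rfl⟩ := (toDerived k).surjective x
    simp only [mul_def, LinearEquiv.symm_apply_apply]
    rw [mul_assoc x, PermRing.mul_left_comm', mul_assoc x,
      PermRing.mul_left_comm' x (DiffPermAlgebra.diff k _ * _),
      PermRing.mul_left_comm' (DiffPermAlgebra.diff k _)]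
  associator_mul_comm' x y z t := by
    obtain ⟨x, rfl⟩ := (toDerived k).surjective x
    obtain ⟨y, rfl⟩ := (toDerived k).surjective y
    simp only [associator_apply, mul_def, LinearEquiv.symm_apply_apply, DiffPermAlgebra.diff_mul,
      mul_add, ← mul_assoc, ← map_sub, sub_add_cancel_left]
    rw [PermRing.mul_left_comm' x y]

instance : LeftPreLieAlgebra k (DerivedAlgebra k P) where

end DerivedAlgebra

/-! ### A polynomial model of a differential Perm-algebra -/

section Model

open MvPolynomial

variable (k : Type u) [Field k] (X : Type v)

/-- Polynomials in the variables `(x, b, n)`, standing for the `n`-th derivative of `x`. A variable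
with `b = true` represents the last letter of a Perm-monomial, one with `b = false` any other
letter. The product is not that of polynomials. -/
def PermModel : Type (max u v) := MvPolynomial (X × Bool × ℕ) k

namespace PermModel

/-- The endomorphism that forgets which letters are last. -/
def unmark : MvPolynomial (X × Bool × ℕ) k →ₐ[k] MvPolynomial (X × Bool × ℕ) k :=
  rename fun v => (v.1, false, v.2.2)

/-- The derivation with `d (x, b, n) = (x, b, n + 1)`. -/
def der : Derivation k (MvPolynomial (X × Bool × ℕ) k) (MvPolynomial (X × Bool × ℕ) k) :=
  mkDerivation k fun v => MvPolynomial.X (v.1, v.2.1, v.2.2 + 1)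

variable {k X}

theorem unmark_X (x : X) (b : Bool) (n : ℕ) :
    unmark k X (MvPolynomial.X (x, b, n)) = MvPolynomial.X (x, false, n) :=
  rename_X _ _

theorem unmark_unmark (f : MvPolynomial (X × Bool × ℕ) k) :
    unmark k X (unmark k X f) = unmark k X f := by
  rw [unmark, rename_rename]; rfl

theorem der_X (x : X) (b : Bool) (n : ℕ) :
    der k X (MvPolynomial.X (x, b, n)) = MvPolynomial.X (x, b, n + 1) :=
  mkDerivation_X _ _ _

theorem der_iterate_X (x : X) (b : Bool) (n : ℕ) :
    (der k X)^[n] (MvPolynomial.X (x, b, 0)) = MvPolynomial.X (x, b, n) := by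
  induction n with
  | zero => rfl
  | succ n ih => rw [Function.iterate_succ_apply', ih, der_X]

theorem unmark_der (f : MvPolynomial (X × Bool × ℕ) k) :
    unmark k X (der k X f) = der k X (unmark k X f) := by
  induction f using MvPolynomial.induction_on with
  | C a => simp [unmark]
  | add p q hp hq => simp only [map_add, hp, hq]
  | mul_X p v hp =>
    obtain ⟨x, b, n⟩ := v
    simp only [Derivation.leibniz, smul_eq_mul, map_add, map_mul, hp, unmark_X, der_X]

instance : AddCommGroup (PermModel k X) :=
  inferInstanceAs (AddCommGroup (MvPolynomial (X × Bool × ℕ) k))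

instance : Module k (PermModel k X) :=
  inferInstanceAs (Module k (MvPolynomial (X × Bool × ℕ) k))

variable (k X) in
/-- The identity map to the underlying space of polynomials. -/
def toPoly : PermModel k X ≃ₗ[k] MvPolynomial (X × Bool × ℕ) k := LinearEquiv.refl k _

instance : Mul (PermModel k X) where
  mul f g := (toPoly k X).symm (unmark k X (toPoly k X f) * toPoly k X g)

theorem toPoly_mul (f g : PermModel k X) :
    toPoly k X (f * g) = unmark k X (toPoly k X f) * toPoly k X g := rfl

instance : PermRing (PermModel k X) where
  left_distrib f g h := (toPoly k X).injective <| by simp only [toPoly_mul, map_add, mul_add]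
  right_distrib f g h := (toPoly k X).injective <| by simp only [toPoly_mul, map_add, add_mul]
  zero_mul f := (toPoly k X).injective <| by simp only [toPoly_mul, map_zero, zero_mul]
  mul_zero f := (toPoly k X).injective <| by simp only [toPoly_mul, map_zero, mul_zero]
  mul_assoc f g h := (toPoly k X).injective <| by
    simp only [toPoly_mul, map_mul, unmark_unmark, mul_assoc]
  mul_left_comm' f g h := (toPoly k X).injective <| by
    simp only [toPoly_mul, map_mul, unmark_unmark]
    rw [mul_comm (unmark k X (toPoly k X f))]

instance : DiffPermAlgebra k (PermModel k X) where
  smul_assoc t f g := (toPoly k X).injective <| by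
    simp only [smul_eq_mul, toPoly_mul, map_smul, smul_mul_assoc]
  smul_comm t f g := (toPoly k X).injective <| by
    simp only [smul_eq_mul, toPoly_mul, map_smul, mul_smul_comm]
  diff' := (toPoly k X).symm.toLinearMap ∘ₗ (der k X).toLinearMap ∘ₗ (toPoly k X).toLinearMap
  leibniz' f g := (toPoly k X).injective <| by
    change der k X (unmark k X (toPoly k X f) * toPoly k X g) =
      unmark k X (der k X (toPoly k X f)) * toPoly k X g +
        unmark k X (toPoly k X f) * der k X (toPoly k X g)
    rw [Derivation.leibniz, unmark_der, smul_eq_mul, smul_eq_mul]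
    ring

theorem toPoly_diff (f : PermModel k X) :
    toPoly k X (DiffPermAlgebra.diff k f) = der k X (toPoly k X f) := rfl

end PermModel

end Model

/-! ### The monomial of a chain -/

section Content

variable {X : Type v}

/-- The multiset of letters of the monomial that represents a chain with vertices `q` and leaves
`m`: every vertex is differentiated as often as it has children, and the root is the last letter. -/
def chainContent : List (X × ℕ) → List X → Multiset (X × Bool × ℕ)
  | [], m => (m : Multiset X).map fun x => (x, true, 0)
  | (z, j) :: q, m => (z, true, j + 1) ::ₘ
      ((q : Multiset (X × ℕ)).map (fun p => (p.1, false, p.2 + 1)) +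
        (m : Multiset X).map fun x => (x, false, 0))

theorem labelledChain_eq_of_chainContent_eq {A : Type*} [SLSRing A] (f : X → A)
    {q q' : List (X × ℕ)} {m m' : List X} (h : m.length = chainLeaves q)
    (h' : m'.length = chainLeaves q') (hc : chainContent q m = chainContent q' m') :
    labelledChain f q m = labelledChain f q' m' := by
  match q, q' with
  | [], [] =>
    rw [chainContent, chainContent] at hc
    have := Multiset.map_injective
      (f := fun x : X => (x, true, 0)) (fun a b hab => (Prod.ext_iff.mp hab).1) hc
    obtain ⟨x, rfl⟩ := List.length_eq_one_iff.mp (h : m.length = 1)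
    rw [Multiset.coe_eq_coe, List.singleton_perm] at this
    rw [← this]
  | [], (z, j) :: q =>
    have : (z, true, j + 1) ∈ chainContent [] m := by
      rw [hc, chainContent]; exact Multiset.mem_cons_self _ _
    simp [chainContent] at this
  | (z, j) :: q, [] =>
    have : (z, true, j + 1) ∈ chainContent [] m' := by
      rw [← hc, chainContent]; exact Multiset.mem_cons_self _ _
    simp [chainContent] at this
  | (z, j) :: q, (z', j') :: q' =>
    have hz : (z, true, j + 1) ∈ chainContent ((z', j') :: q') m' := by
      rw [← hc, chainContent]; exact Multiset.mem_cons_self _ _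
    obtain ⟨rfl, rfl⟩ : z = z' ∧ j = j' := by simpa [chainContent] using hz
    rw [chainContent, chainContent] at hc
    have hc := (Multiset.cons_inj_right _).mp hc
    -- Apart from the root, the vertices are the letters of positive order.
    have hq := congrArg (Multiset.filter fun v : X × Bool × ℕ => v.2.2 ≠ 0) hc
    have hm := congrArg (Multiset.filter fun v : X × Bool × ℕ => v.2.2 = 0) hc
    simp only [Multiset.filter_add, Multiset.filter_map, Function.comp_def] at hq hm
    simp only [ne_eq, Nat.add_eq_zero_iff, one_ne_zero, and_false, not_false_eq_true,
      Multiset.filter_true, not_true_eq_false, Multiset.filter_false, Multiset.map_zero,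
      add_zero, zero_add] at hq hm
    have hq := Multiset.map_injective
      (fun a b hab => by simpa [Prod.ext_iff] using hab) hq
    have hm := Multiset.map_injective (fun a b hab => (Prod.ext_iff.mp hab).1) hm
    refine chain_cons_perm (f z) j ((Multiset.coe_eq_coe.mp hq).map _)
      ((Multiset.coe_eq_coe.mp hm).map _) ?_
    simp only [chainLeaves, List.length_map, List.map_cons, List.map_map] at h ⊢
    exact h

open MvPolynomial PermModel

variable {k : Type u} [Field k]

theorem map_labelledChain {A : Type*} [SLSRing A] {f : X → A}
    {g : A →+ MvPolynomial (X × Bool × ℕ) k} (hf : ∀ x, g (f x) = MvPolynomial.X (x, true, 0))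
    (hg : ∀ a b, g (a * b) = unmark k X (g a) * der k X (g b)) (q : List (X × ℕ)) (m : List X)
    (h : m.length = chainLeaves q) :
    g (labelledChain f q m) = ((chainContent q m).map MvPolynomial.X).prod := by
  have hbrace (u : A) (l : List X) (z : X) : g (brace (u :: l.map f) (f z)) =
      unmark k X (g u) * (l.map fun x => MvPolynomial.X (x, false, 0)).prod *
        MvPolynomial.X (z, true, l.length + 1) := by
    rw [map_brace (unmark k X).toRingHom ((der k X).restrictScalars ℤ) unmark_unmark unmark_der
      g hg]
    have : (l.map f).map (fun a => (unmark k X).toRingHom (g a)) =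
        l.map fun x => MvPolynomial.X (x, false, 0) := by
      rw [List.map_map]
      exact List.map_congr_left fun x _ => by
        rw [Function.comp_apply, hf]; exact unmark_X x true 0
    rw [List.map_cons, this, List.prod_cons, List.length_cons, List.length_map, hf]
    exact congrArg _ (der_iterate_X z true _)
  have hun (q : List (X × ℕ)) (m : List X) (h : m.length = chainLeaves q) :
      unmark k X (g (labelledChain f q m)) =
      (q.map fun p => MvPolynomial.X (p.1, false, p.2 + 1)).prod *
        (m.map fun x => MvPolynomial.X (x, false, 0)).prod := by
    induction q, m, h using labelledChain_induction with
    | leaf x =>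
      have : labelledChain f [] [x] = f x := rfl
      rw [this, hf, unmark_X]; simp
    | node z l q m h ih =>
      have hl : unmark k X (l.map fun x => MvPolynomial.X (x, false, 0)).prod =
          (l.map fun x => MvPolynomial.X (x, false, 0)).prod := by
        rw [map_list_prod, List.map_map]
        congr 1
        exact List.map_congr_left fun x _ => unmark_X x false 0
      rw [labelledChain_cons_append, hbrace, map_mul, map_mul, unmark_unmark, ih, unmark_X, hl]
      simp only [List.map_cons, List.prod_cons, List.map_append, List.prod_append]
      ring
  induction q, m, h using labelledChain_induction with
  | leaf x =>
    have : labelledChain f [] [x] = f x := rfl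
    rw [this, hf]; simp [chainContent]
  | node z l q m h _ =>
    rw [labelledChain_cons_append, hbrace, hun q m h, chainContent, Multiset.map_cons,
      Multiset.prod_cons, Multiset.map_add, Multiset.prod_add]
    simp only [Multiset.map_coe, List.map_map, Multiset.prod_coe, List.map_append,
      List.prod_append, Function.comp_def]
    ring

/-- An additive map that sends chains to their monomials is injective on the span of the chains:
its inverse sends a monomial to the value of any chain that it represents. -/
theorem injOn_chainSpan {A : Type*} [SLSRing A] [LeftPreLieAlgebra k A] {f : X → A}
    {g : A →ₗ[k] MvPolynomial (X × Bool × ℕ) k}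
    (hg : ∀ q m, m.length = chainLeaves q →
      g (labelledChain f q m) = ((chainContent q m).map MvPolynomial.X).prod) :
    Set.InjOn g (chainSpan k f) := by
  classical
  have hX (s : Multiset (X × Bool × ℕ)) : (s.map MvPolynomial.X).prod =
      monomial (R := k) (Multiset.toFinsupp s) 1 := by
    induction s using Multiset.induction_on with
    | empty => simp
    | cons v s ih =>
      rw [Multiset.map_cons, Multiset.prod_cons, ih, MvPolynomial.X, monomial_mul, one_mul,
        ← Multiset.singleton_add, Multiset.toFinsupp_add, Multiset.toFinsupp_singleton]
  let σ : MvPolynomial (X × Bool × ℕ) k →ₗ[k] A :=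
    (basisMonomials (X × Bool × ℕ) k).constr k fun s =>
      if h : ∃ p : List (X × ℕ) × List X, p.2.length = chainLeaves p.1 ∧
          Multiset.toFinsupp (chainContent p.1 p.2) = s
      then labelledChain f h.choose.1 h.choose.2 else 0
  have hσ : ∀ a ∈ chainSpan k f, σ (g a) = a := by
    intro a ha
    induction ha using chainSpan_induction with
    | chain q m h =>
      have hex : ∃ p : List (X × ℕ) × List X, p.2.length = chainLeaves p.1 ∧
          Multiset.toFinsupp (chainContent p.1 p.2) = Multiset.toFinsupp (chainContent q m) :=
        ⟨(q, m), h, rfl⟩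
      have hb : monomial (R := k) (Multiset.toFinsupp (chainContent q m)) 1 =
          basisMonomials (X × Bool × ℕ) k (Multiset.toFinsupp (chainContent q m)) := by
        rw [coe_basisMonomials]
      rw [hg q m h, hX, hb, Module.Basis.constr_basis, dif_pos hex]
      exact labelledChain_eq_of_chainContent_eq f hex.choose_spec.1 h
        (Multiset.toFinsupp.injective hex.choose_spec.2)
    | zero => rw [map_zero, map_zero]
    | add a b _ _ ha hb => rw [map_add, map_add, ha, hb]
    | smul t a _ ha => rw [map_smul, map_smul, ha]
  exact Set.LeftInvOn.injOn (f₁' := σ) hσ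

end Content

/-! ### The free SLS-algebra -/

section Free

variable (k : Type u) [Field k] (X : Type v)

/-- The free SLS-algebra is generated by `X`. -/
theorem FreeSLS.induction_mul {B : Submodule k (FreeSLS k X)}
    (hof : ∀ x, FreeSLS.of k x ∈ B) (hmul : ∀ a ∈ B, ∀ b ∈ B, a * b ∈ B) (a : FreeSLS k X) :
    a ∈ B := by
  let S : NonUnitalSubalgebra k (FreeSLS k X) :=
    { B with mul_mem' := fun {a b} ha hb => hmul a ha b hb }
  let mk : FreeNonUnitalNonAssocAlgebra k X →ₙₐ[k] FreeSLS k X :=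
    { toFun := Quot.mk (FreeSLS.Rel k X)
      map_smul' := fun _ _ => rfl
      map_zero' := rfl
      map_add' := fun _ _ => rfl
      map_mul' := fun _ _ => rfl }
  let F : FreeNonUnitalNonAssocAlgebra k X →ₙₐ[k] S :=
    FreeNonUnitalNonAssocAlgebra.lift k fun x => ⟨FreeSLS.of k x, hof x⟩
  have hF : (NonUnitalSubalgebraClass.subtype S).comp F = mk :=
    FreeNonUnitalNonAssocAlgebra.hom_ext k fun x => by
      change ((F (FreeNonUnitalNonAssocAlgebra.of k x) : S) : FreeSLS k X) = _
      rw [FreeNonUnitalNonAssocAlgebra.lift_of_apply]; rfl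
  obtain ⟨a⟩ := a
  have ha : ((F a : S) : FreeSLS k X) = Quot.mk _ a := NonUnitalAlgHom.congr_fun hF a
  exact ha ▸ (F a).2

theorem FreeSLS.mem_chainSpan (a : FreeSLS k X) : a ∈ chainSpan k (FreeSLS.of k (X := X)) :=
  FreeSLS.induction_mul k X apply_mem_chainSpan (fun _ ha _ hb => mul_mem_chainSpan ha hb) a

theorem injective_toDerived (φ : FreeSLS k X →ₙₐ[k] DerivedAlgebra k (FreePermDer k X))
    (hφ : ∀ x, φ (FreeSLS.of k x) = DerivedAlgebra.toDerived k (FreePermDer.of k x)) :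
    Function.Injective φ := by
  obtain ⟨ψ, ⟨hψ, hd⟩, -⟩ := FreePermDer.existsUnique_lift k (P := PermModel k X)
    fun x => (PermModel.toPoly k X).symm (MvPolynomial.X (x, true, 0))
  let g : FreeSLS k X →ₗ[k] MvPolynomial (X × Bool × ℕ) k :=
    (PermModel.toPoly k X).toLinearMap ∘ₗ (ψ : FreePermDer k X →ₗ[k] PermModel k X) ∘ₗ
      (DerivedAlgebra.toDerived k).symm.toLinearMap ∘ₗ
        (φ : FreeSLS k X →ₗ[k] DerivedAlgebra k (FreePermDer k X))
  have hg (a : FreeSLS k X) :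
      g a = PermModel.toPoly k X (ψ ((DerivedAlgebra.toDerived k).symm (φ a))) := rfl
  have hof (x : X) : g (FreeSLS.of k x) = MvPolynomial.X (x, true, 0) := by
    rw [hg, hφ, LinearEquiv.symm_apply_apply, hψ, LinearEquiv.apply_symm_apply]
  have hmul (a b : FreeSLS k X) :
      g (a * b) = PermModel.unmark k X (g a) * PermModel.der k X (g b) := by
    rw [hg, map_mul, DerivedAlgebra.mul_def, LinearEquiv.symm_apply_apply, map_mul,
      PermModel.toPoly_mul, hd, PermModel.toPoly_diff, ← hg, ← hg]
  have hinj := injOn_chainSpan (g := g)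
    (map_labelledChain (f := FreeSLS.of k) (g := g.toAddMonoidHom) hof hmul)
  intro a b hab
  refine hinj (FreeSLS.mem_chainSpan k X a) (FreeSLS.mem_chainSpan k X b) ?_
  rw [hg, hg, hab]

end Free

end

theorem mainTheorem2 (k : Type u) [Field k] (X : Type v) [Nonempty X] :
    (∃ τ : FreeSLS k X →ₙₐ[k] derivedSubalgebra k X,
      (∀ x : X, (τ (FreeSLS.of k x) : DerivedAlgebra k (FreePermDer k X)) =
        DerivedAlgebra.toDerived k (FreePermDer.of k x)) ∧
      Function.Bijective τ) ∧
    IsSpecial k (FreeSLS k X) := by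
  obtain ⟨φ, hφ, -⟩ := FreeSLS.existsUnique_lift k
    fun x : X => DerivedAlgebra.toDerived k (FreePermDer.of k x)
  have hinj := injective_toDerived k X φ hφ
  have hmem (a : FreeSLS k X) : φ a ∈ derivedSubalgebra k X :=
    FreeSLS.induction_mul k X (B := (derivedSubalgebra k X).toSubmodule.comap
        (φ : FreeSLS k X →ₗ[k] DerivedAlgebra k (FreePermDer k X)))
      (fun x => by
        change φ (FreeSLS.of k x) ∈ derivedSubalgebra k X
        rw [hφ]; exact NonUnitalAlgebra.subset_adjoin k ⟨x, rfl⟩)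
      (fun a ha b hb => by
        change φ (a * b) ∈ derivedSubalgebra k X
        rw [map_mul]; exact mul_mem ha hb) a
  have hrange : derivedSubalgebra k X ≤ NonUnitalAlgHom.range φ :=
    NonUnitalAlgebra.adjoin_le <| by
      rintro _ ⟨x, rfl⟩
      exact ⟨FreeSLS.of k x, hφ x⟩
  refine ⟨⟨NonUnitalAlgHom.codRestrict φ (derivedSubalgebra k X) hmem, hφ, ?_, ?_⟩,
    FreePermDer k X, inferInstance, inferInstance, φ, hinj⟩
  · exact fun a b hab => hinj (congrArg Subtype.val hab)
  · rintro ⟨b, hb⟩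
    obtain ⟨a, rfl⟩ := hrange hb
    exact ⟨a, rfl⟩
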